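/- Let $d\ge 2$, let $\mu=(u_1,\dots,u_n)^T\in\mathbb{R}^n$ and $\nu=(v_1,\dots,v_m)^T\in\mathbb{R}^m$ be real vectors with Euclidean norms $|\mu|,|\nu|$, and let $\rho$ be a state (density matrix) on $\mathbb{C}^d\otimes\mathbb{C}^d\otimes\mathbb{C}^d$. Then $$C_{GME}(\rho)\;\ge\;\frac{1}{\sqrt{d(d-1)}}\left(\mathscr{Q}(\rho)-\sqrt{(|\mu|^2+1)(|\nu|^2+1)}-\frac{2(d-1)}{3}\right).$$ Here the notation is as follows. * For a matrix $X$, $\mathrm{Vec}(X)$ is the vector obtained by stacking its columns, and $\|X\|_{\mathrm{Tr}}=\mathrm{Tr}\sqrt{X^\dagger X}$. For a matrix $Z=(Z_{i,j})_{i,j=1}^{d_A}$ on $\mathbb{C}^{d_A}\otimes\mathbb{C}^{d_B}$ with blocks $Z_{i,j}\in\mathbb{C}^{d_B\times d_B}$, the realigned matrix $\mathcal{R}(Z)$ has rows $\mathrm{Vec}(Z_{1,1})^T,\dots,\mathrm{Vec}(Z_{d_A,1})^T,\dots,\mathrm{Vec}(Z_{1,d_A})^T,\dots,\mathrm{Vec}(Z_{d_A,d_A})^T$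 in this order. * For a bipartite state $\sigma$ on $\mathbb{C}^{d_A}\otimes\mathbb{C}^{d_B}$ with reduced matrices $\sigma_A=\mathrm{Tr}_B\,\sigma$ and $\sigma_B=\mathrm{Tr}_A\,\sigma$, $$\mathcal{Q}_{\mu,\nu}(\sigma)=\begin{pmatrix}\mu\nu^T & \mu\,\mathrm{Vec}(\sigma_B)^T\\ \mathrm{Vec}(\sigma_A)\,\nu^T & \mathcal{R}(\sigma)\end{pmatrix}.$$ * $\mathscr{Q}(\rho)=\frac13\left(\|\mathscr{Q}_{1|23}(\rho)\|_{\mathrm{Tr}}+\|\mathscr{Q}_{2|13}(\rho)\|_{\mathrm{Tr}}+\|\mathscr{Q}_{3|12}(\rho)\|_{\mathrm{Tr}}\right)$, where $\mathscr{Q}_{i|jk}(\rho)$ is the matrix $\mathcal{Q}_{\mu,\nu}$ of $\rho$ regarded as a bipartite state with $A=i$ and $B=jk$. * For a unit vector $|\varphi\rangle\in(\mathbb{C}^d)^{\otimes 3}$ with one-party reduced density matrices $\rho_1,\rho_2,\rho_3$, $C_{GME}(|\varphi\rangle)=\sqrt{\min\{1-\mathrm{Tr}(\rho_1^2),\,1-\mathrm{Tr}(\rho_2^2),\,1-\mathrm{Tr}(\rho_3^2)\}}$;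 and for a state $\rho$, $C_{GME}(\rho)$ is the infimum of $\sum_i p_i\,C_{GME}(|\varphi_i\rangle)$ over all finite decompositions $\rho=\sum_i p_i|\varphi_i\rangle\langle\varphi_i|$ into unit vectors with $p_i\ge0$, $\sum_i p_i=1$. -/

import Mathlib

open scoped ComplexOrder in
/-- A state (density matrix): positive semidefinite with unit trace. -/
def IsState {ι : Type*} [Fintype ι] (ρ : Matrix ι ι ℂ) : Prop :=
  ρ.PosSemidef ∧ ρ.trace = 1

open scoped MatrixOrder in
/-- The trace norm `Tr √(Aᴴ A)` (the trace of a positive semidefinite matrix is real). -/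
noncomputable def traceNorm {m n : Type*} [Fintype m] [Fintype n] [DecidableEq n]
    (A : Matrix m n ℂ) : ℝ :=
  (CFC.sqrt (A.conjTranspose * A)).trace.re

/-- The partial trace over the first subsystem; the result is the reduced matrix `ρ_B`. -/
def traceFst {A B : Type*} [Fintype A] (ρ : Matrix (A × B) (A × B) ℂ) : Matrix B B ℂ :=
  Matrix.of fun b b' => ∑ a, ρ (a, b) (a, b')

/-- The partial trace over the second subsystem; the result is the reduced matrix `ρ_A`. -/
def traceSnd {A B : Type*} [Fintype B] (ρ : Matrix (A × B) (A × B) ℂ) : Matrix A A ℂ :=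
  Matrix.of fun a a' => ∑ b, ρ (a, b) (a', b)

/-- The realigned matrix. The block `Z i j` has entries `Z (i, b) (j, b')`; the row of the
realigned matrix at `(j, i)` is the (column-stacking) vectorization of that block, the rows being
enumerated in the same column-major order as the entries of a vectorization. -/
def realign {A B : Type*} (Z : Matrix (A × B) (A × B) ℂ) : Matrix (A × A) (B × B) ℂ :=
  Matrix.of fun p => Matrix.vec (Z.submatrix (fun b => (p.2, b)) (fun b => (p.1, b)))

/-- The matrix `Q_{μ,ν}(ρ)` of a bipartite `ρ`, with blocks
`μ νᵀ`, `μ Vec(ρ_B)ᵀ`, `Vec(ρ_A) νᵀ` and the realigned matrix of `ρ`. -/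
noncomputable def Qmat {A B : Type*} [Fintype A] [Fintype B] {n m : ℕ}
    (μ : EuclideanSpace ℝ (Fin n)) (ν : EuclideanSpace ℝ (Fin m))
    (ρ : Matrix (A × B) (A × B) ℂ) : Matrix (Fin n ⊕ A × A) (Fin m ⊕ B × B) ℂ :=
  Matrix.fromBlocks
    (Matrix.vecMulVec (fun i => (μ i : ℂ)) (fun j => (ν j : ℂ)))
    (Matrix.vecMulVec (fun i => (μ i : ℂ)) (traceFst ρ).vec)
    (Matrix.vecMulVec (traceSnd ρ).vec (fun j => (ν j : ℂ)))
    (realign ρ)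

/-- Index set of the standard basis of `ℂ^d ⊗ ℂ^d ⊗ ℂ^d`. -/
abbrev Tri (d : ℕ) : Type := Fin d × Fin d × Fin d

/-- A tripartite matrix regarded as bipartite under the bipartition `1|23`. -/
def cut1 {d : ℕ} (ρ : Matrix (Tri d) (Tri d) ℂ) : Matrix (Tri d) (Tri d) ℂ :=
  ρ

/-- A tripartite matrix regarded as bipartite under the bipartition `2|13`: the index
`(j, (i, k))` stands for the basis vector `|i j k⟩`. -/
def cut2 {d : ℕ} (ρ : Matrix (Tri d) (Tri d) ℂ) : Matrix (Tri d) (Tri d) ℂ :=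
  ρ.submatrix (fun x => (x.2.1, x.1, x.2.2)) (fun x => (x.2.1, x.1, x.2.2))

/-- A tripartite matrix regarded as bipartite under the bipartition `3|12`: the index
`(k, (i, j))` stands for the basis vector `|i j k⟩`. -/
def cut3 {d : ℕ} (ρ : Matrix (Tri d) (Tri d) ℂ) : Matrix (Tri d) (Tri d) ℂ :=
  ρ.submatrix (fun x => (x.2.1, x.2.2, x.1)) (fun x => (x.2.1, x.2.2, x.1))

/-- The average of the trace norms of `Q_{μ,ν}` over the three bipartitions. -/
noncomputable def Qavg {d n m : ℕ}
    (μ : EuclideanSpace ℝ (Fin n)) (ν : EuclideanSpace ℝ (Fin m))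
    (ρ : Matrix (Tri d) (Tri d) ℂ) : ℝ :=
  (1 / 3) * (traceNorm (Qmat μ ν (cut1 ρ)) + traceNorm (Qmat μ ν (cut2 ρ))
    + traceNorm (Qmat μ ν (cut3 ρ)))

/-- The matrix `|φ⟩⟨φ|`. -/
noncomputable def ketbra {ι : Type*} (φ : EuclideanSpace ℂ ι) : Matrix ι ι ℂ :=
  Matrix.vecMulVec (fun i => φ i) (fun i => star (φ i))

/-- The purity `Tr σ²`, which is real for Hermitian `σ`. -/
noncomputable def purity {ι : Type*} [Fintype ι] (σ : Matrix ι ι ℂ) : ℝ :=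
  (σ * σ).trace.re

/-- The GME concurrence of a (unit) vector `φ` of `ℂ^d ⊗ ℂ^d ⊗ ℂ^d`. -/
noncomputable def pureGME {d : ℕ} (φ : EuclideanSpace ℂ (Tri d)) : ℝ :=
  √(min (1 - purity (traceSnd (cut1 (ketbra φ))))
    (min (1 - purity (traceSnd (cut2 (ketbra φ))))
      (1 - purity (traceSnd (cut3 (ketbra φ))))))

/-- `(p, φ)` is a (finite) pure-state ensemble decomposition of `ρ`. -/
def IsEnsemble {ι : Type*} [Fintype ι] (ρ : Matrix ι ι ℂ) {N : ℕ} (p : Fin N → ℝ)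
    (φ : Fin N → EuclideanSpace ℂ ι) : Prop :=
  (∀ i, 0 ≤ p i) ∧ ∑ i, p i = 1 ∧ (∀ i, ‖φ i‖ = 1) ∧ ρ = ∑ i, (p i : ℂ) • ketbra (φ i)

/-- The average pure-state GME concurrences of all ensemble decompositions of `ρ`. -/
def ensembleGME {d : ℕ} (ρ : Matrix (Tri d) (Tri d) ℂ) : Set ℝ :=
  {x | ∃ (N : ℕ) (p : Fin N → ℝ) (φ : Fin N → EuclideanSpace ℂ (Tri d)),
    IsEnsemble ρ p φ ∧ x = ∑ i, p i * pureGME (φ i)}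

/-- The GME concurrence of a state `ρ`: the convex roof of the pure-state one. -/
noncomputable def GMEConcurrence {d : ℕ} (ρ : Matrix (Tri d) (Tri d) ℂ) : ℝ :=
  sInf (ensembleGME ρ)

open scoped ComplexOrder in
/-- Every state has an ensemble decomposition, so the infimum is over a nonempty set. -/
theorem ensembleGME_nonempty {d : ℕ} {ρ : Matrix (Tri d) (Tri d) ℂ} (hρ : IsState ρ) :
    (ensembleGME ρ).Nonempty := by
  obtain ⟨hpos, htr⟩ := hρ
  have hH := hpos.isHermitian
  let e := (Fintype.equivFin (Tri d)).symm
  refine ⟨_, _, fun i => hH.eigenvalues (e i), fun i => hH.eigenvectorBasis (e i),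
    ⟨fun i => hpos.eigenvalues_nonneg _, ?_, fun i => hH.eigenvectorBasis.orthonormal.1 _, ?_⟩, rfl⟩
  · rw [e.sum_comp (fun i => hH.eigenvalues i)]
    have h := hH.trace_eq_sum_eigenvalues
    rw [htr] at h
    have h2 : ((∑ i, hH.eigenvalues i : ℝ) : ℂ) = 1 := by
      rw [h]; push_cast; rfl
    exact_mod_cast h2
  · rw [e.sum_comp (fun i => (hH.eigenvalues i : ℂ) • ketbra (hH.eigenvectorBasis i))]
    conv_lhs => rw [hH.spectral_theorem, Unitary.conjStarAlgAut_apply]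
    ext x y
    rw [Matrix.mul_apply, Matrix.sum_apply]
    refine Finset.sum_congr rfl fun j _ => ?_
    simp [Matrix.mul_diagonal, ketbra, Matrix.vecMulVec_apply, Matrix.star_apply]
    ring

/-- The values are nonnegative, so the infimum is over a set that is bounded below. -/
theorem ensembleGME_bddBelow {d : ℕ} (ρ : Matrix (Tri d) (Tri d) ℂ) :
    BddBelow (ensembleGME ρ) := by
  refine ⟨0, ?_⟩
  rintro x ⟨N, p, φ, h, rfl⟩
  exact Finset.sum_nonneg fun i _ => mul_nonneg (h.1 i) (Real.sqrt_nonneg _)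

/-!
The trace norm of `∑ |xᵢ⟩⟨yᵢ|` is at most `∑ ‖xᵢ‖ ‖yᵢ‖`. A Schmidt decomposition
`φ = ∑ sₖ uₖ ⊗ wₖ` of a bipartite unit vector splits `Q_{μ,ν}(|φ⟩⟨φ|)` into rank one pieces indexed
by pairs `(k, l)`: the pieces with `k = l` carry all of `μ` and `ν` and contribute at most
`√((‖μ‖² + 1)(‖ν‖² + 1))` altogether, the others contribute `sₖ sₗ` each, that is `(∑ sₖ)² - 1` in
total. By Cauchy–Schwarz this is at most `d - 1`, and also at most `√(d(d - 1))` times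
`√(1 - ∑ sₖ⁴)`, the square root of the linear entropy of the reduced state. In the average over the
three cuts the second bound is used for the cut attaining the minimum in the GME concurrence and the
first one for the other two. Mixed states follow by convexity of the trace norm.
-/

section Dyad

variable {l m n κ : Type*}

/-- The operator `|x⟩⟨y|`; thus `ketbra x = dyad x x`. -/
noncomputable def dyad (x : EuclideanSpace ℂ m) (y : EuclideanSpace ℂ n) : Matrix m n ℂ :=
  Matrix.vecMulVec x (star ⇑y)

theorem dyad_apply (x : EuclideanSpace ℂ m) (y : EuclideanSpace ℂ n) (i : m) (j : n) :
    dyad x y i j = x i * star (y j) :=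
  rfl

theorem conjTranspose_dyad (x : EuclideanSpace ℂ m) (y : EuclideanSpace ℂ n) :
    (dyad x y).conjTranspose = dyad y x := by
  simp [dyad, Matrix.conjTranspose_vecMulVec]

theorem smul_dyad (c : ℂ) (x : EuclideanSpace ℂ m) (y : EuclideanSpace ℂ n) :
    c • dyad x y = dyad (c • x) y := by
  simp [dyad, Matrix.smul_vecMulVec]

theorem dyad_mul_dyad [Fintype n] (x : EuclideanSpace ℂ m) (y z : EuclideanSpace ℂ n)
    (t : EuclideanSpace ℂ l) : dyad x y * dyad z t = inner ℂ y z • dyad x t := by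
  simp [dyad, Matrix.vecMulVec_mul_vecMulVec, Matrix.vecMulVec_smul,
    EuclideanSpace.inner_eq_star_dotProduct, dotProduct_comm]

theorem trace_dyad [Fintype m] (x y : EuclideanSpace ℂ m) : (dyad x y).trace = inner ℂ y x :=
  Matrix.trace_vecMulVec _ _

theorem trace_dyad_mul_dyad [Fintype m] [Fintype n] (x t : EuclideanSpace ℂ m)
    (y z : EuclideanSpace ℂ n) : (dyad x y * dyad z t).trace = inner ℂ y z * inner ℂ t x := by
  rw [dyad_mul_dyad, Matrix.trace_smul, trace_dyad, smul_eq_mul]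

theorem sum_smul_dyad_mul_sum_smul_dyad [Fintype n] [Fintype κ] {v : κ → EuclideanSpace ℂ n}
    (hv : Orthonormal ℂ v) (c d : κ → ℂ) (x : κ → EuclideanSpace ℂ m)
    (z : κ → EuclideanSpace ℂ l) :
    (∑ k, c k • dyad (x k) (v k)) * ∑ k, d k • dyad (v k) (z k) =
      ∑ k, (c k * d k) • dyad (x k) (z k) := by
  classical
  simp [Matrix.sum_mul, Matrix.mul_sum, dyad_mul_dyad, orthonormal_iff_ite.1 hv, smul_smul,
    mul_comm]

theorem trace_sum_smul_ketbra [Fintype n] [Fintype κ] {v : κ → EuclideanSpace ℂ n}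
    (hv : Orthonormal ℂ v) (c : κ → ℂ) :
    (∑ k, c k • ketbra (v k)).trace = ∑ k, c k := by
  have htrace (k : κ) : (ketbra (v k)).trace = 1 :=
    (trace_dyad _ _).trans (inner_self_eq_one_of_norm_eq_one (hv.1 k))
  simp only [Matrix.trace_sum, Matrix.trace_smul, htrace, smul_eq_mul, mul_one]

end Dyad

/-- A (reduced) singular value decomposition `A = ∑ₖ sₖ |uₖ⟩⟨wₖ|`. The index type `κ` is arbitrary,
so singular values equal to `0` may be listed or left out. -/
structure IsSVD {m n κ : Type*} [Fintype m] [Fintype n] [Fintype κ] (A : Matrix m n ℂ) (s : κ → ℝ)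
    (u : κ → EuclideanSpace ℂ m) (w : κ → EuclideanSpace ℂ n) : Prop where
  nonneg (k : κ) : 0 ≤ s k
  left : Orthonormal ℂ u
  right : Orthonormal ℂ w
  eq_sum : A = ∑ k, (s k : ℂ) • dyad (u k) (w k)

namespace IsSVD

variable {m n κ : Type*} [Fintype m] [Fintype n] [Fintype κ] {A : Matrix m n ℂ} {s : κ → ℝ}
  {u : κ → EuclideanSpace ℂ m} {w : κ → EuclideanSpace ℂ n}

theorem conjTranspose (h : IsSVD A s u w) : IsSVD A.conjTranspose s w u where
  nonneg := h.nonneg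
  left := h.right
  right := h.left
  eq_sum := by
    simp [h.eq_sum, Matrix.conjTranspose_sum, Matrix.conjTranspose_smul, conjTranspose_dyad]

theorem mul_conjTranspose (h : IsSVD A s u w) :
    A * A.conjTranspose = ∑ k, (s k : ℂ) ^ 2 • ketbra (u k) := by
  rw [h.conjTranspose.eq_sum, h.eq_sum, sum_smul_dyad_mul_sum_smul_dyad h.right]
  simp only [← sq]
  rfl

theorem conjTranspose_mul (h : IsSVD A s u w) :
    A.conjTranspose * A = ∑ k, (s k : ℂ) ^ 2 • ketbra (w k) := by
  simpa using h.conjTranspose.mul_conjTranspose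

theorem trace_mul_conjTranspose (h : IsSVD A s u w) :
    (A * A.conjTranspose).trace = ((∑ k, s k ^ 2 : ℝ) : ℂ) := by
  rw [h.mul_conjTranspose, trace_sum_smul_ketbra h.left]
  norm_cast

theorem purity_mul_conjTranspose (h : IsSVD A s u w) :
    purity (A * A.conjTranspose) = ∑ k, s k ^ 4 := by
  have hsq : A * A.conjTranspose * (A * A.conjTranspose) =
      ∑ k, ((s k : ℂ) ^ 2 * (s k : ℂ) ^ 2) • ketbra (u k) := by
    rw [h.mul_conjTranspose]
    exact sum_smul_dyad_mul_sum_smul_dyad h.left _ _ u u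
  rw [purity, hsq, trace_sum_smul_ketbra h.left]
  simp only [← pow_add]
  norm_cast

theorem trace_mul_dyad (h : IsSVD A s u w) (k : κ) : (A * dyad (w k) (u k)).trace = s k := by
  classical
  simp [h.eq_sum, Matrix.sum_mul, Matrix.trace_sum, trace_dyad_mul_dyad,
    orthonormal_iff_ite.1 h.left, orthonormal_iff_ite.1 h.right]

open scoped ComplexOrder MatrixOrder in
theorem traceNorm_eq [DecidableEq n] (h : IsSVD A s u w) : traceNorm A = ∑ k, s k := by
  have hpos : 0 ≤ ∑ k, (s k : ℂ) • ketbra (w k) :=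
    Finset.sum_nonneg fun k _ => ((Matrix.posSemidef_vecMulVec_self_star ⇑(w k)).smul
      (Complex.zero_le_real.2 (h.nonneg k))).nonneg
  have hsqrt : CFC.sqrt (A.conjTranspose * A) = ∑ k, (s k : ℂ) • ketbra (w k) := by
    refine CFC.sqrt_unique ?_ hpos
    rw [h.conjTranspose_mul]
    simp only [sq]
    exact sum_smul_dyad_mul_sum_smul_dyad h.right _ _ w w
  rw [traceNorm, hsqrt, trace_sum_smul_ketbra h.right, ← Complex.ofReal_sum, Complex.ofReal_re]

end IsSVD

section SVDExistence

variable {l m n : Type*} [Fintype n]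

theorem mul_dyad (A : Matrix m n ℂ) (x : EuclideanSpace ℂ n) (y : EuclideanSpace ℂ l) :
    A * dyad x y = dyad (WithLp.toLp 2 (A.mulVec x)) y :=
  Matrix.mul_vecMulVec _ _ _

theorem sum_ketbra_orthonormalBasis [DecidableEq n]
    (b : OrthonormalBasis n ℂ (EuclideanSpace ℂ n)) : ∑ k, ketbra (b k) = 1 := by
  ext i j
  have h := b.sum_inner_mul_inner (EuclideanSpace.single i 1) (EuclideanSpace.single j 1)
  simpa [Matrix.sum_apply, ketbra, Matrix.vecMulVec_apply, Matrix.one_apply,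
    EuclideanSpace.inner_single_left, EuclideanSpace.inner_single_right, eq_comm] using h

theorem sum_dyad_mulVec_orthonormalBasis (A : Matrix m n ℂ)
    (b : OrthonormalBasis n ℂ (EuclideanSpace ℂ n)) :
    ∑ k, dyad (WithLp.toLp 2 (A.mulVec (b k))) (b k) = A := by
  classical
  simp only [← mul_dyad, ← Matrix.mul_sum]
  exact (congrArg (A * ·) (sum_ketbra_orthonormalBasis b)).trans A.mul_one

variable [Fintype m]

theorem inner_mulVec_mulVec (A : Matrix m n ℂ) (x y : EuclideanSpace ℂ n) :
    inner ℂ (WithLp.toLp 2 (A.mulVec x)) (WithLp.toLp 2 (A.mulVec y)) =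
      inner ℂ x (WithLp.toLp 2 ((A.conjTranspose * A).mulVec y)) := by
  simp only [EuclideanSpace.inner_eq_star_dotProduct, Matrix.star_mulVec,
    dotProduct_comm _ (star _), ← Matrix.mulVec_mulVec]
  rw [dotProduct_comm, ← Matrix.dotProduct_mulVec]

theorem inner_mulVec_eigenvectorBasis [DecidableEq n] (A : Matrix m n ℂ)
    (hA : (A.conjTranspose * A).IsHermitian) (j k : n) :
    inner ℂ (WithLp.toLp 2 (A.mulVec (hA.eigenvectorBasis j)))
        (WithLp.toLp 2 (A.mulVec (hA.eigenvectorBasis k))) =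
      if j = k then (hA.eigenvalues k : ℂ) else 0 := by
  rw [inner_mulVec_mulVec, hA.mulVec_eigenvectorBasis, WithLp.toLp_smul, WithLp.toLp_ofLp,
    RCLike.real_smul_eq_coe_smul (K := ℂ), inner_smul_right,
    orthonormal_iff_ite.1 hA.eigenvectorBasis.orthonormal]
  simp

theorem exists_isSVD (A : Matrix m n ℂ) :
    ∃ (r : ℕ) (s : Fin r → ℝ) (u : Fin r → EuclideanSpace ℂ m) (w : Fin r → EuclideanSpace ℂ n),
      IsSVD A s u w := by
  classical
  have hA : (A.conjTranspose * A).IsHermitian := Matrix.isHermitian_conjTranspose_mul_self A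
  have hinner := inner_mulVec_eigenvectorBasis A hA
  have hnonneg := Matrix.eigenvalues_conjTranspose_mul_self_nonneg A
  set eig := hA.eigenvalues
  set v := hA.eigenvectorBasis
  set Av : n → EuclideanSpace ℂ m := fun j => WithLp.toLp 2 (A.mulVec (v j))
  have hker (j : n) (hj : eig j = 0) : Av j = 0 := by
    rw [← inner_self_eq_zero (𝕜 := ℂ), hinner, if_pos rfl, hj, Complex.ofReal_zero]
  let e := (Fintype.equivFin {j // eig j ≠ 0}).symm
  have hsqrt (k) : (√(eig (e k)) : ℂ) ≠ 0 :=
    Complex.ofReal_ne_zero.2 (Real.sqrt_ne_zero'.2 ((hnonneg _).lt_of_ne' (e k).2))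
  refine ⟨_, fun k => √(eig (e k)), fun k => (√(eig (e k)) : ℂ)⁻¹ • Av (e k), fun k => v (e k),
    fun k => Real.sqrt_nonneg _, ?_, ?_, ?_⟩
  · rw [orthonormal_iff_ite]
    intro j k
    rw [inner_smul_left, inner_smul_right, hinner]
    rcases eq_or_ne j k with rfl | hjk
    · rw [if_pos rfl, if_pos rfl, ← mul_assoc, map_inv₀, Complex.conj_ofReal, ← mul_inv,
        ← Complex.ofReal_mul, Real.mul_self_sqrt (hnonneg _),
        inv_mul_cancel₀ (Complex.ofReal_ne_zero.2 (e j).2)]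
    · simp [hjk, Subtype.val_injective.eq_iff]
  · exact v.orthonormal.comp _ (Subtype.val_injective.comp e.injective)
  · calc A = ∑ j, dyad (Av j) (v j) := (sum_dyad_mulVec_orthonormalBasis A v).symm
      _ = ∑ j : {j // eig j ≠ 0}, dyad (Av j) (v j) := by
          rw [← Fintype.sum_subtype_add_sum_subtype (eig · ≠ 0), add_eq_left]
          exact Finset.sum_eq_zero fun j _ => by simp [hker j (not_not.1 j.2), dyad]
      _ = ∑ k, dyad (Av (e k)) (v (e k)) :=
          (e.sum_comp fun j : {j // eig j ≠ 0} => dyad (Av j) (v j)).symm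
      _ = ∑ k, (√(eig (e k)) : ℂ) • dyad ((√(eig (e k)) : ℂ)⁻¹ • Av (e k)) (v (e k)) := by
          simp only [smul_dyad, smul_inv_smul₀ (hsqrt _)]

end SVDExistence

section TraceNorm

variable {m n ι : Type*} [Fintype m] [Fintype n] [Fintype ι] [DecidableEq n]

theorem sum_norm_inner_mul_norm_inner_le {E F : Type*} [NormedAddCommGroup E]
    [InnerProductSpace ℂ E] [NormedAddCommGroup F] [InnerProductSpace ℂ F] {κ : Type*} [Fintype κ]
    {u : κ → E} {w : κ → F} (hu : Orthonormal ℂ u) (hw : Orthonormal ℂ w) (x : E) (y : F) :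
    ∑ k, ‖(inner ℂ (u k) x : ℂ)‖ * ‖(inner ℂ (w k) y : ℂ)‖ ≤ ‖x‖ * ‖y‖ := by
  refine (Real.sum_mul_le_sqrt_mul_sqrt _ _ _).trans ?_
  gcongr
  · exact Real.sqrt_le_iff.2 ⟨norm_nonneg x, hu.sum_inner_products_le x⟩
  · exact Real.sqrt_le_iff.2 ⟨norm_nonneg y, hw.sum_inner_products_le y⟩

theorem traceNorm_sum_dyad_le (x : ι → EuclideanSpace ℂ m) (y : ι → EuclideanSpace ℂ n) :
    traceNorm (∑ i, dyad (x i) (y i)) ≤ ∑ i, ‖x i‖ * ‖y i‖ := by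
  obtain ⟨r, s, u, w, h⟩ := exists_isSVD (∑ i, dyad (x i) (y i))
  have hs (k : Fin r) : s k ≤ ∑ i, ‖(inner ℂ (u k) (x i) : ℂ)‖ * ‖(inner ℂ (w k) (y i) : ℂ)‖ :=
    calc s k = ‖∑ i, (inner ℂ (y i) (w k) : ℂ) * inner ℂ (u k) (x i)‖ := by
          simp only [← trace_dyad_mul_dyad, ← Matrix.trace_sum, ← Matrix.sum_mul]
          rw [h.trace_mul_dyad, Complex.norm_of_nonneg (h.nonneg k)]
      _ ≤ ∑ i, ‖(inner ℂ (y i) (w k) : ℂ) * inner ℂ (u k) (x i)‖ := norm_sum_le _ _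
      _ = _ := by simp only [norm_mul, norm_inner_symm (y _), mul_comm]
  calc traceNorm (∑ i, dyad (x i) (y i)) = ∑ k, s k := h.traceNorm_eq
    _ ≤ ∑ k, ∑ i, ‖(inner ℂ (u k) (x i) : ℂ)‖ * ‖(inner ℂ (w k) (y i) : ℂ)‖ :=
        Finset.sum_le_sum fun k _ => hs k
    _ = ∑ i, ∑ k, ‖(inner ℂ (u k) (x i) : ℂ)‖ * ‖(inner ℂ (w k) (y i) : ℂ)‖ := Finset.sum_comm
    _ ≤ ∑ i, ‖x i‖ * ‖y i‖ := Finset.sum_le_sum fun i _ =>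
        sum_norm_inner_mul_norm_inner_le h.left h.right (x i) (y i)

theorem traceNorm_sum_smul_le (c : ι → ℂ) (A : ι → Matrix m n ℂ) :
    traceNorm (∑ i, c i • A i) ≤ ∑ i, ‖c i‖ * traceNorm (A i) := by
  choose r s u w h using fun i => exists_isSVD (A i)
  calc traceNorm (∑ i, c i • A i)
      = traceNorm (∑ k : (i : ι) × Fin (r i),
          dyad (c k.1 • (s k.1 k.2 : ℂ) • u k.1 k.2) (w k.1 k.2)) := by
        simp only [Fintype.sum_sigma, ← smul_dyad, ← Finset.smul_sum, ← (h _).eq_sum]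
    _ ≤ ∑ k : (i : ι) × Fin (r i), ‖c k.1 • (s k.1 k.2 : ℂ) • u k.1 k.2‖ * ‖w k.1 k.2‖ :=
        traceNorm_sum_dyad_le _ _
    _ = ∑ i, ‖c i‖ * traceNorm (A i) := by
        simp [Fintype.sum_sigma, norm_smul, (h _).left.1, (h _).right.1, (h _).traceNorm_eq,
          Finset.mul_sum, abs_of_nonneg ((h _).nonneg _)]

end TraceNorm

section PureState

variable {A B κ : Type*} {n m : ℕ}

/-- The coefficient matrix of a bipartite vector; its singular value decompositions are the Schmidt
decompositions of the vector. -/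
def coeffMatrix (φ : EuclideanSpace ℂ (A × B)) : Matrix A B ℂ :=
  Matrix.of fun a b => φ (a, b)

theorem traceSnd_ketbra [Fintype B] (φ : EuclideanSpace ℂ (A × B)) :
    traceSnd (ketbra φ) = coeffMatrix φ * (coeffMatrix φ).conjTranspose :=
  rfl

variable [Fintype A]

theorem traceFst_ketbra (φ : EuclideanSpace ℂ (A × B)) :
    traceFst (ketbra φ) = ((coeffMatrix φ).conjTranspose * coeffMatrix φ).transpose := by
  ext b b'
  exact Finset.sum_congr rfl fun a _ => mul_comm _ _

variable [Fintype B] [Fintype κ]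

theorem trace_coeffMatrix_mul_conjTranspose (φ : EuclideanSpace ℂ (A × B)) :
    (coeffMatrix φ * (coeffMatrix φ).conjTranspose).trace = ((‖φ‖ ^ 2 : ℝ) : ℂ) := by
  simp [EuclideanSpace.norm_sq_eq, Matrix.trace, Matrix.mul_apply, coeffMatrix,
    Fintype.sum_prod_type, Complex.mul_conj']

theorem IsSVD.sum_sq_eq_norm_sq {φ : EuclideanSpace ℂ (A × B)} {s : κ → ℝ}
    {u : κ → EuclideanSpace ℂ A} {w : κ → EuclideanSpace ℂ B}
    (h : IsSVD (coeffMatrix φ) s u w) : ∑ k, s k ^ 2 = ‖φ‖ ^ 2 := by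
  have htrace := h.trace_mul_conjTranspose
  rw [trace_coeffMatrix_mul_conjTranspose] at htrace
  exact_mod_cast htrace.symm

/-- The column `(μ, Vec X)`, from which the rank one pieces of `Q_{μ,ν}` are built. -/
noncomputable def augmentedVec (μ : EuclideanSpace ℝ (Fin n)) (X : Matrix A A ℂ) :
    EuclideanSpace ℂ (Fin n ⊕ A × A) :=
  WithLp.toLp 2 (Sum.elim (fun i => (μ i : ℂ)) X.vec)

theorem norm_augmentedVec_dyad (μ : EuclideanSpace ℝ (Fin n)) (x y : EuclideanSpace ℂ A) :
    ‖augmentedVec μ (dyad x y)‖ = √(‖μ‖ ^ 2 + (‖x‖ * ‖y‖) ^ 2) := by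
  rw [EuclideanSpace.norm_eq]
  simp only [augmentedVec, Fintype.sum_sum_type, Fintype.sum_prod_type, Matrix.vec, dyad_apply,
    Sum.elim_inl, Sum.elim_inr, norm_mul, norm_star, mul_pow, Complex.norm_real,
    EuclideanSpace.norm_sq_eq, Finset.sum_mul_sum]
  rw [Finset.sum_comm]

theorem realign_ketbra_eq_sum {φ : EuclideanSpace ℂ (A × B)} {s : κ → ℝ}
    {u : κ → EuclideanSpace ℂ A} {w : κ → EuclideanSpace ℂ B} (h : IsSVD (coeffMatrix φ) s u w) :
    realign (ketbra φ) = ∑ p : κ × κ, ((s p.1 * s p.2 : ℝ) : ℂ) •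
      Matrix.vecMulVec (dyad (u p.1) (u p.2)).vec (star (dyad (w p.1) (w p.2)).vec) := by
  have happly (a : A) (b : B) : φ (a, b) = ∑ k, (s k : ℂ) * dyad (u k) (w k) a b :=
    (congrFun₂ h.eq_sum a b).trans (by simp [Matrix.sum_apply])
  ext p q
  change φ (p.2, q.2) * star (φ (p.1, q.1)) = _
  rw [happly, happly, star_sum, Fintype.sum_mul_sum, Matrix.sum_apply, Fintype.sum_prod_type]
  refine Finset.sum_congr rfl fun k _ => Finset.sum_congr rfl fun l _ => ?_
  simp only [Matrix.smul_apply, Matrix.vecMulVec_apply, Matrix.vec, Pi.star_apply, dyad_apply,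
    RCLike.star_def, star_mul', Complex.conj_ofReal, RingHomCompTriple.comp_apply, RingHom.id_apply,
    Complex.ofReal_mul, smul_eq_mul]
  ring

theorem Qmat_ketbra_eq_sum [DecidableEq κ] (μ : EuclideanSpace ℝ (Fin n))
    (ν : EuclideanSpace ℝ (Fin m)) {φ : EuclideanSpace ℂ (A × B)} (hφ : ‖φ‖ = 1) {s : κ → ℝ}
    {u : κ → EuclideanSpace ℂ A} {w : κ → EuclideanSpace ℂ B} (h : IsSVD (coeffMatrix φ) s u w) :
    Qmat μ ν (ketbra φ) = ∑ p : κ × κ, ((s p.1 * s p.2 : ℝ) : ℂ) •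
      dyad (augmentedVec (if p.1 = p.2 then μ else 0) (dyad (u p.1) (u p.2)))
        (augmentedVec (if p.1 = p.2 then ν else 0) (dyad (w p.1) (w p.2))) := by
  have hs : ∑ k, (s k : ℂ) ^ 2 = 1 := by
    have hs' := h.sum_sq_eq_norm_sq
    rw [hφ, one_pow] at hs'
    exact_mod_cast hs'
  have hcoe {N : ℕ} (x : EuclideanSpace ℝ (Fin N)) (k l : κ) (i : Fin N) :
      (((if k = l then x else 0) i : ℝ) : ℂ) = if k = l then (x i : ℂ) else 0 := by
    split_ifs <;> simp
  ext (i | p) (j | q)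
  · simp [Qmat, Matrix.sum_apply, dyad_apply, augmentedVec, Matrix.vecMulVec_apply, hcoe,
      Fintype.sum_prod_type, ← sq, ← Finset.sum_mul, hs]
  · change (μ i : ℂ) * traceFst (ketbra φ) q.2 q.1 = _
    rw [traceFst_ketbra, h.conjTranspose_mul]
    simp [Matrix.sum_apply, dyad_apply, augmentedVec, Matrix.vecMulVec_apply, hcoe, Matrix.vec,
      ketbra, Fintype.sum_prod_type, Finset.mul_sum, ← sq, mul_comm, mul_left_comm]
  · change traceSnd (ketbra φ) p.2 p.1 * (ν j : ℂ) = _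
    rw [traceSnd_ketbra, h.mul_conjTranspose]
    simp [Matrix.sum_apply, dyad_apply, augmentedVec, Matrix.vecMulVec_apply, hcoe, Matrix.vec,
      ketbra, Fintype.sum_prod_type, Finset.sum_mul, sq, mul_assoc, apply_ite (starRingEnd ℂ)]
  · change realign (ketbra φ) p q = _
    rw [realign_ketbra_eq_sum h]
    simp [Matrix.sum_apply, dyad_apply, augmentedVec, Matrix.vecMulVec_apply]

theorem traceNorm_Qmat_ketbra_le [DecidableEq B] (μ : EuclideanSpace ℝ (Fin n))
    (ν : EuclideanSpace ℝ (Fin m)) {φ : EuclideanSpace ℂ (A × B)} (hφ : ‖φ‖ = 1) {s : κ → ℝ}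
    {u : κ → EuclideanSpace ℂ A} {w : κ → EuclideanSpace ℂ B} (h : IsSVD (coeffMatrix φ) s u w) :
    traceNorm (Qmat μ ν (ketbra φ)) ≤
      √((‖μ‖ ^ 2 + 1) * (‖ν‖ ^ 2 + 1)) + ((∑ k, s k) ^ 2 - 1) := by
  classical
  set K := √((‖μ‖ ^ 2 + 1) * (‖ν‖ ^ 2 + 1)) with hK
  have hs : ∑ k, s k * s k = 1 := by
    simp only [← sq, h.sum_sq_eq_norm_sq, hφ, one_pow]
  have hterm (p : κ × κ) :
      ‖((s p.1 * s p.2 : ℝ) : ℂ) •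
          augmentedVec (if p.1 = p.2 then μ else 0) (dyad (u p.1) (u p.2))‖ *
        ‖augmentedVec (if p.1 = p.2 then ν else 0) (dyad (w p.1) (w p.2))‖ =
      s p.1 * s p.2 * if p.1 = p.2 then K else 1 := by
    rw [norm_smul, Complex.norm_of_nonneg (mul_nonneg (h.nonneg _) (h.nonneg _)),
      norm_augmentedVec_dyad, norm_augmentedVec_dyad, h.left.1, h.left.1, h.right.1, h.right.1,
      mul_assoc]
    split_ifs
    · rw [hK, Real.sqrt_mul (by positivity)]
      norm_num
    · norm_num
  calc traceNorm (Qmat μ ν (ketbra φ))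
      ≤ ∑ p : κ × κ, s p.1 * s p.2 * if p.1 = p.2 then K else 1 := by
        rw [Qmat_ketbra_eq_sum μ ν hφ h]
        simp only [smul_dyad]
        exact (traceNorm_sum_dyad_le _ _).trans_eq (Finset.sum_congr rfl fun p _ => hterm p)
    _ = ∑ k, ∑ l, (s k * s l + if k = l then s k * s l * (K - 1) else 0) := by
        rw [Fintype.sum_prod_type]
        refine Finset.sum_congr rfl fun k _ => Finset.sum_congr rfl fun l _ => ?_
        split_ifs <;> ring
    _ = (∑ k, s k) ^ 2 + (K - 1) := by
        simp only [Finset.sum_add_distrib, Finset.sum_ite_eq, Finset.mem_univ, if_true,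
          ← Finset.sum_mul, hs, one_mul, sq, Finset.sum_mul_sum]
    _ = K + ((∑ k, s k) ^ 2 - 1) := by ring

end PureState

section SchmidtCoefficients

variable {κ : Type*} [Fintype κ]

theorem sum_offDiag_mul (s : κ → ℝ) :
    ∑ p ∈ (Finset.univ : Finset κ).offDiag, s p.1 * s p.2 = (∑ k, s k) ^ 2 - ∑ k, s k ^ 2 := by
  classical
  rw [eq_sub_iff_add_eq', sq, Fintype.sum_mul_sum, ← Finset.sum_product',
    ← Finset.diag_union_offDiag, Finset.sum_union (Finset.disjoint_diag_offDiag _),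
    Finset.sum_diag]
  simp only [sq]

theorem sq_sum_sub_one_le_card_sub_one {s : κ → ℝ} (hs : ∑ k, s k ^ 2 = 1) :
    (∑ k, s k) ^ 2 - 1 ≤ (Fintype.card κ : ℝ) - 1 := by
  have h := sq_sum_le_card_mul_sum_sq (s := Finset.univ) (f := s)
  rw [hs, mul_one, Finset.card_univ] at h
  exact sub_le_sub_right h 1

theorem sq_sum_sub_one_le_sqrt_mul_sqrt {s : κ → ℝ} (hs : ∑ k, s k ^ 2 = 1) :
    (∑ k, s k) ^ 2 - 1 ≤
      √((Fintype.card κ : ℝ) * ((Fintype.card κ : ℝ) - 1)) * √(1 - ∑ k, s k ^ 4) := by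
  have hcard : ((Finset.univ : Finset κ).offDiag.card : ℝ) =
      (Fintype.card κ : ℝ) * ((Fintype.card κ : ℝ) - 1) := by
    rw [Finset.offDiag_card, Finset.card_univ, Nat.cast_sub (Nat.le_mul_self _)]
    push_cast
    ring
  have hsq : ∑ p ∈ (Finset.univ : Finset κ).offDiag, (s p.1 * s p.2) ^ 2 = 1 - ∑ k, s k ^ 4 := by
    have h := sum_offDiag_mul fun k => s k ^ 2
    simp only [← mul_pow, hs, one_pow, ← pow_mul] at h
    exact h
  rw [← hcard, ← hsq, ← Real.sqrt_mul (Nat.cast_nonneg _), ← hs, ← sum_offDiag_mul]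
  exact Real.le_sqrt_of_sq_le sq_sum_le_card_mul_sum_sq

end SchmidtCoefficients

section BipartitePure

variable {A B : Type*} [Fintype A] [Fintype B]

theorem IsSVD.card_le {κ : Type*} [Fintype κ] {M : Matrix A B ℂ} {s : κ → ℝ}
    {u : κ → EuclideanSpace ℂ A} {w : κ → EuclideanSpace ℂ B} (h : IsSVD M s u w) :
    Fintype.card κ ≤ Fintype.card A :=
  h.left.linearIndependent.fintype_card_le_finrank.trans_eq finrank_euclideanSpace

variable [DecidableEq B] {n m : ℕ} (μ : EuclideanSpace ℝ (Fin n)) (ν : EuclideanSpace ℝ (Fin m))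

theorem traceNorm_Qmat_ketbra_le_card {φ : EuclideanSpace ℂ (A × B)} (hφ : ‖φ‖ = 1) :
    traceNorm (Qmat μ ν (ketbra φ)) ≤
      √((‖μ‖ ^ 2 + 1) * (‖ν‖ ^ 2 + 1)) + ((Fintype.card A : ℝ) - 1) := by
  obtain ⟨r, s, u, w, h⟩ := exists_isSVD (coeffMatrix φ)
  have hs : ∑ k, s k ^ 2 = 1 := by rw [h.sum_sq_eq_norm_sq, hφ, one_pow]
  have hr : (Fintype.card (Fin r) : ℝ) ≤ Fintype.card A := Nat.cast_le.2 h.card_le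
  linarith [traceNorm_Qmat_ketbra_le μ ν hφ h, sq_sum_sub_one_le_card_sub_one hs]

theorem traceNorm_Qmat_ketbra_le_sqrt_one_sub_purity {φ : EuclideanSpace ℂ (A × B)}
    (hφ : ‖φ‖ = 1) :
    traceNorm (Qmat μ ν (ketbra φ)) ≤ √((‖μ‖ ^ 2 + 1) * (‖ν‖ ^ 2 + 1)) +
      √((Fintype.card A : ℝ) * ((Fintype.card A : ℝ) - 1)) *
        √(1 - purity (traceSnd (ketbra φ))) := by
  obtain ⟨r, s, u, w, h⟩ := exists_isSVD (coeffMatrix φ)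
  have hs : ∑ k, s k ^ 2 = 1 := by rw [h.sum_sq_eq_norm_sq, hφ, one_pow]
  have hr : (Fintype.card (Fin r) : ℝ) ≤ Fintype.card A := Nat.cast_le.2 h.card_le
  have hone : (1 : ℝ) ≤ Fintype.card (Fin r) := by
    have : Nonempty (Fin r) := by
      by_contra hempty
      rw [not_nonempty_iff] at hempty
      simp at hs
    exact Nat.one_le_cast.2 Fintype.card_pos
  rw [traceSnd_ketbra, h.purity_mul_conjTranspose]
  refine (traceNorm_Qmat_ketbra_le μ ν hφ h).trans (add_le_add_right ?_ _)
  refine (sq_sum_sub_one_le_sqrt_mul_sqrt hs).trans ?_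
  gcongr

end BipartitePure

section Mixtures

variable {A B ι : Type*} [Fintype ι]

theorem traceFst_sum_smul [Fintype A] (c : ι → ℂ) (σ : ι → Matrix (A × B) (A × B) ℂ) :
    traceFst (∑ i, c i • σ i) = ∑ i, c i • traceFst (σ i) := by
  ext b b'
  simp only [traceFst, Matrix.of_apply, Matrix.sum_apply, Matrix.smul_apply, Finset.smul_sum]
  exact Finset.sum_comm

theorem traceSnd_sum_smul [Fintype B] (c : ι → ℂ) (σ : ι → Matrix (A × B) (A × B) ℂ) :
    traceSnd (∑ i, c i • σ i) = ∑ i, c i • traceSnd (σ i) := by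
  ext a a'
  simp only [traceSnd, Matrix.of_apply, Matrix.sum_apply, Matrix.smul_apply, Finset.smul_sum]
  exact Finset.sum_comm

variable [Fintype A] [Fintype B] {n m : ℕ} (μ : EuclideanSpace ℝ (Fin n))
  (ν : EuclideanSpace ℝ (Fin m))

-- The block `μνᵀ` does not depend on the state, so `Q_{μ,ν}` is affine but not linear.
theorem Qmat_sum_smul {c : ι → ℂ} (hc : ∑ i, c i = 1) (σ : ι → Matrix (A × B) (A × B) ℂ) :
    Qmat μ ν (∑ i, c i • σ i) = ∑ i, c i • Qmat μ ν (σ i) := by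
  ext (i | x) (j | y)
  · simp [Qmat, Matrix.sum_apply, Matrix.vecMulVec_apply, ← Finset.sum_mul, hc]
  · simp [Qmat, Matrix.sum_apply, Matrix.vecMulVec_apply, Matrix.vec, traceFst_sum_smul,
      Finset.mul_sum, mul_left_comm]
  · simp [Qmat, Matrix.sum_apply, Matrix.vecMulVec_apply, Matrix.vec, traceSnd_sum_smul,
      Finset.sum_mul, mul_assoc]
  · simp [Qmat, Matrix.sum_apply, realign, Matrix.vec]

variable {p : ι → ℝ}

theorem traceNorm_Qmat_sum_smul_le [DecidableEq B] (hp : ∑ i, p i = 1) (hp0 : ∀ i, 0 ≤ p i)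
    (σ : ι → Matrix (A × B) (A × B) ℂ) :
    traceNorm (Qmat μ ν (∑ i, (p i : ℂ) • σ i)) ≤ ∑ i, p i * traceNorm (Qmat μ ν (σ i)) := by
  rw [Qmat_sum_smul μ ν (by exact_mod_cast hp)]
  refine (traceNorm_sum_smul_le _ _).trans_eq ?_
  simp only [Complex.norm_real, Real.norm_of_nonneg (hp0 _)]

theorem Qavg_sum_smul_le {d : ℕ} (hp : ∑ i, p i = 1) (hp0 : ∀ i, 0 ≤ p i)
    (σ : ι → Matrix (Tri d) (Tri d) ℂ) :
    Qavg μ ν (∑ i, (p i : ℂ) • σ i) ≤ ∑ i, p i * Qavg μ ν (σ i) := by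
  have hcut2 : cut2 (∑ i, (p i : ℂ) • σ i) = ∑ i, (p i : ℂ) • cut2 (σ i) := by
    ext x y
    simp [cut2, Matrix.sum_apply]
  have hcut3 : cut3 (∑ i, (p i : ℂ) • σ i) = ∑ i, (p i : ℂ) • cut3 (σ i) := by
    ext x y
    simp [cut3, Matrix.sum_apply]
  simp only [Qavg, cut1, hcut2, hcut3, mul_left_comm (p _) (1 / 3 : ℝ), ← Finset.mul_sum, mul_add,
    Finset.sum_add_distrib]
  gcongr <;> exact traceNorm_Qmat_sum_smul_le μ ν hp hp0 _

end Mixtures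

section Tripartite

theorem exists_ketbra_eq_submatrix {ι κ : Type*} [Fintype ι] [Fintype κ] (e : κ ≃ ι)
    (φ : EuclideanSpace ℂ ι) :
    ∃ ψ : EuclideanSpace ℂ κ, ‖ψ‖ = ‖φ‖ ∧ ketbra ψ = (ketbra φ).submatrix e e :=
  ⟨LinearIsometryEquiv.piLpCongrLeft 2 ℂ ℂ e.symm φ, LinearIsometryEquiv.norm_map _ _, rfl⟩

variable {d n m : ℕ} (μ : EuclideanSpace ℝ (Fin n)) (ν : EuclideanSpace ℝ (Fin m))

theorem exists_ketbra_eq_cut2 (φ : EuclideanSpace ℂ (Tri d)) :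
    ∃ ψ : EuclideanSpace ℂ (Tri d), ‖ψ‖ = ‖φ‖ ∧ ketbra ψ = cut2 (ketbra φ) :=
  exists_ketbra_eq_submatrix
    (Function.Involutive.toPerm (fun x : Tri d => (x.2.1, x.1, x.2.2)) fun _ => rfl) φ

theorem exists_ketbra_eq_cut3 (φ : EuclideanSpace ℂ (Tri d)) :
    ∃ ψ : EuclideanSpace ℂ (Tri d), ‖ψ‖ = ‖φ‖ ∧ ketbra ψ = cut3 (ketbra φ) :=
  exists_ketbra_eq_submatrix
    (⟨fun x => (x.2.1, x.2.2, x.1), fun x => (x.2.2, x.1, x.2.1), fun _ => rfl, fun _ => rfl⟩ :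
      Tri d ≃ Tri d) φ

-- The purity bound is spent on the cut of smallest linear entropy alone and the other two cuts
-- contribute `d - 1` each, hence the weights `1 / 3` and `2 / 3` coming from the average.
theorem Qavg_ketbra_le {φ : EuclideanSpace ℂ (Tri d)} (hφ : ‖φ‖ = 1) :
    Qavg μ ν (ketbra φ) ≤ √((‖μ‖ ^ 2 + 1) * (‖ν‖ ^ 2 + 1)) + 2 * ((d : ℝ) - 1) / 3 +
      √((d : ℝ) * ((d : ℝ) - 1)) / 3 * pureGME φ := by
  obtain ⟨ψ₂, hψ₂, hcut2⟩ := exists_ketbra_eq_cut2 φ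
  obtain ⟨ψ₃, hψ₃, hcut3⟩ := exists_ketbra_eq_cut3 φ
  have hcard {ψ : EuclideanSpace ℂ (Tri d)} (hψ : ‖ψ‖ = ‖φ‖) :=
    traceNorm_Qmat_ketbra_le_card μ ν (hψ.trans hφ)
  have hpurity {ψ : EuclideanSpace ℂ (Tri d)} (hψ : ‖ψ‖ = ‖φ‖) :=
    traceNorm_Qmat_ketbra_le_sqrt_one_sub_purity μ ν (hψ.trans hφ)
  simp only [Fintype.card_fin] at hcard hpurity
  rw [Qavg, pureGME, cut1, ← hcut2, ← hcut3]
  rcases min_choice (1 - purity (traceSnd (ketbra φ)))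
    (min (1 - purity (traceSnd (ketbra ψ₂))) (1 - purity (traceSnd (ketbra ψ₃)))) with h | h
  · rw [h]
    linarith [hpurity (rfl : ‖φ‖ = ‖φ‖), hcard hψ₂, hcard hψ₃]
  · rcases min_choice (1 - purity (traceSnd (ketbra ψ₂))) (1 - purity (traceSnd (ketbra ψ₃)))
      with h' | h' <;> rw [h, h']
    · linarith [hcard (rfl : ‖φ‖ = ‖φ‖), hpurity hψ₂, hcard hψ₃]
    · linarith [hcard (rfl : ‖φ‖ = ‖φ‖), hcard hψ₂, hpurity hψ₃]

theorem Qavg_le_of_mem_ensembleGME {ρ : Matrix (Tri d) (Tri d) ℂ} {x : ℝ}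
    (hx : x ∈ ensembleGME ρ) :
    Qavg μ ν ρ ≤ √((‖μ‖ ^ 2 + 1) * (‖ν‖ ^ 2 + 1)) + 2 * ((d : ℝ) - 1) / 3 +
      √((d : ℝ) * ((d : ℝ) - 1)) / 3 * x := by
  obtain ⟨N, p, φ, ⟨hp0, hp, hφ, rfl⟩, rfl⟩ := hx
  refine (Qavg_sum_smul_le μ ν hp hp0 _).trans ((Finset.sum_le_sum fun i _ =>
    mul_le_mul_of_nonneg_left (Qavg_ketbra_le μ ν (hφ i)) (hp0 i)).trans_eq ?_)
  simp only [mul_add _ _ (_ * pureGME _), Finset.sum_add_distrib, ← Finset.sum_mul, hp, one_mul,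
    mul_left_comm (p _), ← Finset.mul_sum]

theorem GMEConcurrence_nonneg (ρ : Matrix (Tri d) (Tri d) ℂ) : 0 ≤ GMEConcurrence ρ := by
  refine Real.sInf_nonneg ?_
  rintro _ ⟨N, p, φ, h, rfl⟩
  exact Finset.sum_nonneg fun i _ => mul_nonneg (h.1 i) (Real.sqrt_nonneg _)

end Tripartite

theorem theorem6_general {d n m : ℕ} (μ : EuclideanSpace ℝ (Fin n)) (ν : EuclideanSpace ℝ (Fin m))
    {ρ : Matrix (Tri d) (Tri d) ℂ} (hρ : IsState ρ) :
    Qavg μ ν ρ ≤ √((‖μ‖ ^ 2 + 1) * (‖ν‖ ^ 2 + 1)) + 2 * ((d : ℝ) - 1) / 3 +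
      √((d : ℝ) * ((d : ℝ) - 1)) / 3 * GMEConcurrence ρ := by
  have hc : 0 ≤ √((d : ℝ) * ((d : ℝ) - 1)) / 3 := by positivity
  rw [← sub_le_iff_le_add', GMEConcurrence, ← smul_eq_mul (_ / 3), ← Real.sInf_smul_of_nonneg hc]
  refine le_csInf (ensembleGME_nonempty hρ).smul_set ?_
  rintro _ ⟨x, hx, rfl⟩
  exact sub_le_iff_le_add'.2 (Qavg_le_of_mem_ensembleGME μ ν hx)

theorem theorem6 (d : ℕ) (hd : 2 ≤ d) (n m : ℕ)
    (μ : EuclideanSpace ℝ (Fin n)) (ν : EuclideanSpace ℝ (Fin m))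
    (ρ : Matrix (Tri d) (Tri d) ℂ) (hρ : IsState ρ) :
    GMEConcurrence ρ ≥ 1 / √((d : ℝ) * ((d : ℝ) - 1)) *
      (Qavg μ ν ρ - √((‖μ‖ ^ 2 + 1) * (‖ν‖ ^ 2 + 1)) - 2 * ((d : ℝ) - 1) / 3) := by
  have hd' : (2 : ℝ) ≤ d := Nat.ofNat_le_cast.2 hd
  have hc : 0 < √((d : ℝ) * ((d : ℝ) - 1)) := Real.sqrt_pos.2 (by nlinarith)
  rw [ge_iff_le, one_div, inv_mul_le_iff₀ hc]
  linarith [theorem6_general μ ν hρ, mul_nonneg hc.le (GMEConcurrence_nonneg ρ)]
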